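/- Let $n,m,T$ be positive integers, let $(A_{\rm true},B_{\rm true})\in\mathbb{R}^{n\times n}\times\mathbb{R}^{n\times m}$, and let $\mathcal{D}$ consist of inputs $u(0),\dots,u(T-1)\in\mathbb{R}^m$ and states $x(0),\dots,x(T)\in\mathbb{R}^n$ satisfying $x(t+1)=A_{\rm true}x(t)+B_{\rm true}u(t)$ for $t=0,\dots,T-1$. Put $$U_-=[u(0)\ \cdots\ u(T-1)],\quad X_-=[x(0)\ \cdots\ x(T-1)],\quad X_+=[x(1)\ \cdots\ x(T)],$$ and let $\Sigma_{\mathcal D}=\{(A,B)\in\mathbb{R}^{n\times n}\times\mathbb{R}^{n\times m} : X_+=AX_-+BU_-\}$ be the set of data-consistent systems. A real square matrix is called Schur if all its complex eigenvalues have modulus less than $1$; a pair $(A,B)$ is called stabilizable if $A+BK$ is Schur for some $K\in\mathbb{R}^{m\times n}$; and $\Sigma_{\rm stab}\subseteq\mathbb{R}^{n\times n}\times\mathbb{R}^{n\times m}$ is the set of stabilizable pairs. Suppose that $(A_{\rm true},B_{\rm true})\in\Sigma_{\rm stab}$ and $\operatorname{rank}X_-=n$. Then the following statements are equivalent: (a)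 The data $\mathcal{D}$ are $\Sigma_{\rm stab}$-informative for stabilization, i.e., there exists $K\in\mathbb{R}^{m\times n}$ such that $A+BK$ is Schur for all $(A,B)\in\Sigma_{\mathcal D}\cap\Sigma_{\rm stab}$. (b) The data $\mathcal{D}$ are informative for stabilization, i.e., there exists $K\in\mathbb{R}^{m\times n}$ such that $A+BK$ is Schur for all $(A,B)\in\Sigma_{\mathcal D}$. -/

import Mathlib

open scoped Matrix

/-- A real square matrix is Schur if all its (complex) eigenvalues lie in the open unit disk. -/
def IsSchur {n : ℕ} (M : Matrix (Fin n) (Fin n) ℝ) : Prop :=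
  ∀ z ∈ spectrum ℂ (M.map (algebraMap ℝ ℂ)), ‖z‖ < 1

/-- The set `𝓜 = ℝ^{n×n} × ℝ^{n×m}` of systems with `n` states and `m` inputs. -/
abbrev LTISystem (n m : ℕ) : Type :=
  Matrix (Fin n) (Fin n) ℝ × Matrix (Fin n) (Fin m) ℝ

/-- `(A, B)` is stabilizable if `A + B K` is Schur for some state feedback gain `K`. -/
def IsStabilizable {n m : ℕ} (S : LTISystem n m) : Prop :=
  ∃ K : Matrix (Fin m) (Fin n) ℝ, IsSchur (S.1 + S.2 * K)

/-- The set of stabilizable systems. -/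
def stabSystems (n m : ℕ) : Set (LTISystem n m) :=
  {S | IsStabilizable S}

/-- Input-state data `u(0), …, u(T-1)` and `x(0), …, x(T)`. -/
structure InputStateData (n m T : ℕ) where
  /-- the input samples -/
  u : Fin T → Fin m → ℝ
  /-- the state samples -/
  x : Fin (T + 1) → Fin n → ℝ

namespace InputStateData

variable {n m T : ℕ}

/-- The matrix `U₋ = [u(0) ⋯ u(T-1)]`. -/
def Uminus (D : InputStateData n m T) : Matrix (Fin m) (Fin T) ℝ :=
  Matrix.of fun i t => D.u t i

/-- The matrix `X₋ = [x(0) ⋯ x(T-1)]`. -/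
def Xminus (D : InputStateData n m T) : Matrix (Fin n) (Fin T) ℝ :=
  Matrix.of fun i t => D.x t.castSucc i

/-- The matrix `X₊ = [x(1) ⋯ x(T)]`. -/
def Xplus (D : InputStateData n m T) : Matrix (Fin n) (Fin T) ℝ :=
  Matrix.of fun i t => D.x t.succ i

/-- The data are collected from the system `x(t+1) = A x(t) + B u(t)`. -/
def CollectedFrom (D : InputStateData n m T) (S : LTISystem n m) : Prop :=
  ∀ t : Fin T, D.x t.succ = S.1 *ᵥ D.x t.castSucc + S.2 *ᵥ D.u t

/-- The set of data-consistent systems. -/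
def consistentSystems (D : InputStateData n m T) : Set (LTISystem n m) :=
  {S | D.Xplus = S.1 * D.Xminus + S.2 * D.Uminus}

/-- Informativity for stabilization (without prior knowledge). -/
def InformativeForStabilization (D : InputStateData n m T) : Prop :=
  ∃ K : Matrix (Fin m) (Fin n) ℝ, ∀ S ∈ D.consistentSystems, IsSchur (S.1 + S.2 * K)

/-- `P`-informativity for stabilization, for a set `P` of systems expressing prior knowledge. -/
def PriorInformativeForStabilization (D : InputStateData n m T)
    (P : Set (LTISystem n m)) : Prop :=
  ∃ K : Matrix (Fin m) (Fin n) ℝ, ∀ S ∈ D.consistentSystems ∩ P, IsSchur (S.1 + S.2 * K)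

end InputStateData

/-! Only (a) ⇒ (b) has content: a gain `K` that works for the stabilizable consistent systems gives
every consistent system the same closed loop as the true one. Two consistent systems differ by rows
`(a, b)` with `a X₋ + b U₋ = 0`, so it suffices that `c = a + b K` vanishes
(`add_vecMul_eq_zero_of_stabilizing`). If `c ≠ 0`, the rank condition forces `b ≠ 0`. Every shift
`(A + v a, B + v b)` remains consistent, and `exists_isStabilizable_not_isSchur` chooses `v` so that
the shifted system is stabilizable, but not by `K`: a contradiction. Failure to be Schur is detected
by the bounds on the trace and on the characteristic polynomial. -/

open Polynomial in
/-- The characteristic polynomial of a Schur matrix is bounded independently of the matrix. -/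
theorem IsSchur.norm_eval_charpoly_le {n : ℕ} {M : Matrix (Fin n) (Fin n) ℝ} (hM : IsSchur M)
    (z : ℂ) : ‖(M.map (algebraMap ℝ ℂ)).charpoly.eval z‖ ≤ (‖z‖ + 1) ^ n := by
  set p := (M.map (algebraMap ℝ ℂ)).charpoly with hp
  have hs : p.Splits := IsAlgClosed.splits p
  have hmonic : p.Monic := Matrix.charpoly_monic _
  have hcard : p.roots.card = n := by
    rw [← hs.natDegree_eq_card_roots, hp, Matrix.charpoly_natDegree_eq_dim, Fintype.card_fin]
  have hbound : ∀ r ∈ p.roots, ‖z - r‖ ≤ ‖z‖ + 1 := fun r hr =>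
    (norm_sub_le z r).trans <| by
      have := hM r (Matrix.mem_spectrum_iff_isRoot_charpoly.2 (isRoot_of_mem_roots hr))
      linarith
  rw [hs.eval_eq_prod_roots_of_monic hmonic, ← hcard]
  generalize p.roots = s at hbound
  induction s using Multiset.induction with
  | empty => simp
  | cons a s ih =>
    rw [Multiset.map_cons, Multiset.prod_cons, Multiset.card_cons, norm_mul, pow_succ']
    exact mul_le_mul (hbound a (Multiset.mem_cons_self a s))
      (ih fun r hr => hbound r (Multiset.mem_cons_of_mem hr)) (norm_nonneg _) (by positivity)

/-- The trace of a Schur matrix is bounded by its size. -/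
theorem IsSchur.abs_trace_le {n : ℕ} {M : Matrix (Fin n) (Fin n) ℝ} (hM : IsSchur M) :
    |M.trace| ≤ n := by
  have htr : ((M.trace : ℝ) : ℂ) = (M.map (algebraMap ℝ ℂ)).trace := by
    simp [Matrix.trace]
  have hs := IsAlgClosed.splits (M.map (algebraMap ℝ ℂ)).charpoly
  have hcard : (M.map (algebraMap ℝ ℂ)).charpoly.roots.card = n := by
    rw [← hs.natDegree_eq_card_roots, Matrix.charpoly_natDegree_eq_dim, Fintype.card_fin]
  rw [← Real.norm_eq_abs, ← Complex.norm_real, htr, Matrix.trace_eq_sum_roots_charpoly]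
  refine (norm_multiset_sum_le _).trans ((Multiset.sum_le_card_nsmul _ 1 ?_).trans ?_)
  · intro x hx
    obtain ⟨r, hr, rfl⟩ := Multiset.mem_map.1 hx
    exact (hM r (Matrix.mem_spectrum_iff_isRoot_charpoly.2 (Polynomial.isRoot_of_mem_roots hr))).le
  · rw [Multiset.card_map, hcard]; simp

/-- If a rank-one update of a Schur matrix is not Schur, then neither are all sufficiently large
multiples of the update. -/
theorem IsSchur.exists_not_isSchur_add_smul_vecMulVec {n : ℕ} {M : Matrix (Fin n) (Fin n) ℝ}
    (hM : IsSchur M) {w c : Fin n → ℝ} (h : ¬ IsSchur (M + Matrix.vecMulVec w c)) :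
    ∃ s : ℝ, 1 < s ∧ ¬ IsSchur (M + s • Matrix.vecMulVec w c) := by
  have h' := h
  unfold IsSchur at h'
  push Not at h'
  obtain ⟨z, hz, hz1⟩ := h'
  set P : Matrix (Fin n) (Fin n) ℂ := Matrix.scalar (Fin n) z - M.map (algebraMap ℝ ℂ) with hP
  have hP0 : P.det ≠ 0 := by
    intro h0
    refine hz1.not_gt (hM z (Matrix.mem_spectrum_iff_isRoot_charpoly.2 ?_))
    rw [Polynomial.IsRoot, Matrix.eval_charpoly, h0]
  let u : Matrix (Fin n) Unit ℂ := Matrix.replicateCol Unit fun i => (w i : ℂ)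
  let v : Matrix Unit (Fin n) ℂ := Matrix.replicateRow Unit fun i => (c i : ℂ)
  set q : ℂ := (v * P⁻¹ * u) () () with hq
  have hdet : ∀ s : ℝ, ((M + s • Matrix.vecMulVec w c).map (algebraMap ℝ ℂ)).charpoly.eval z =
      P.det * (1 - s * q) := by
    intro s
    have hmat : Matrix.scalar (Fin n) z - (M + s • Matrix.vecMulVec w c).map (algebraMap ℝ ℂ) =
        P + (-(s : ℂ) • u) * v := by
      ext i j
      simp [hP, u, v, Matrix.vecMulVec_apply, Matrix.mul_apply]
      ring
    rw [Matrix.eval_charpoly, hmat, Matrix.det_add_mul _ _ (isUnit_iff_ne_zero.2 hP0),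
      Matrix.det_unique (n := Unit)]
    simp [hq, sub_eq_add_neg]
  -- At `s = 1` the point `z` is an eigenvalue, so the value at `z` is `P.det * (1 - s)`, which is
  -- unbounded in `s`.
  have hq1 : q = 1 := by
    have h1 := hdet 1
    rw [one_smul] at h1
    rw [Matrix.mem_spectrum_iff_isRoot_charpoly, Polynomial.IsRoot, h1, mul_eq_zero] at hz
    have := hz.resolve_left hP0
    push_cast at this
    linear_combination -this
  have hPpos : 0 < ‖P.det‖ := norm_pos_iff.2 hP0
  -- For this `s` the value at `z` has norm `‖P.det‖ + (‖z‖ + 1) ^ n`, above the Schur bound.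
  refine ⟨2 + (‖z‖ + 1) ^ n / ‖P.det‖, ?_, fun hs => ?_⟩
  · have : 0 ≤ (‖z‖ + 1) ^ n / ‖P.det‖ := by positivity
    linarith
  · have hle := hs.norm_eval_charpoly_le z
    have hnn : 0 ≤ (‖z‖ + 1) ^ n / ‖P.det‖ := by positivity
    have hsub : (1 : ℂ) - ((2 + (‖z‖ + 1) ^ n / ‖P.det‖ : ℝ) : ℂ) * 1 =
        ((-(1 + (‖z‖ + 1) ^ n / ‖P.det‖) : ℝ) : ℂ) := by push_cast; ring
    rw [hdet, hq1, norm_mul, hsub, Complex.norm_real, Real.norm_eq_abs, abs_neg,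
      abs_of_nonneg (by linarith), mul_add, mul_div_cancel₀ _ hPpos.ne'] at hle
    linarith

/-- A nonzero row vector admits rank-one updates that destroy the Schur property. -/
theorem exists_not_isSchur_add_vecMulVec {n : ℕ} (M : Matrix (Fin n) (Fin n) ℝ)
    {c : Fin n → ℝ} (hc : c ≠ 0) : ∃ v : Fin n → ℝ, ¬ IsSchur (M + Matrix.vecMulVec v c) := by
  have hcc : c ⬝ᵥ c ≠ 0 := fun h => hc (dotProduct_self_eq_zero.1 h)
  -- The scaling makes the trace of the update equal to `n + 1`.
  refine ⟨((n + 1 - M.trace) / (c ⬝ᵥ c)) • c, fun h => ?_⟩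
  have hle := (le_abs_self _).trans h.abs_trace_le
  rw [Matrix.trace_add, Matrix.trace_vecMulVec, smul_dotProduct, smul_eq_mul,
    div_mul_cancel₀ _ hcc] at hle
  linarith

/-- Moving a system along the direction `(v a, v b)` with `b ≠ 0` and `a + b K ≠ 0`, one finds a
stabilizable system that is not stabilized by `K`. -/
theorem exists_isStabilizable_not_isSchur {n m : ℕ} {A : Matrix (Fin n) (Fin n) ℝ}
    {B : Matrix (Fin n) (Fin m) ℝ} {K : Matrix (Fin m) (Fin n) ℝ} (hK : IsSchur (A + B * K))
    {a : Fin n → ℝ} {b : Fin m → ℝ} (hb : b ≠ 0) (hc : a + b ᵥ* K ≠ 0) :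
    ∃ v : Fin n → ℝ,
      IsStabilizable (A + Matrix.vecMulVec v a, B + Matrix.vecMulVec v b) ∧
      ¬ IsSchur (A + Matrix.vecMulVec v a + (B + Matrix.vecMulVec v b) * K) := by
  set c := a + b ᵥ* K with hcdef
  have hbb : b ⬝ᵥ b ≠ 0 := fun h => hb (dotProduct_self_eq_zero.1 h)
  -- With this normalization the shifted input matrix sends `φ` to `w - v`, so a gain correction
  -- along `φ` can cancel `v`.
  obtain ⟨φ, hφ⟩ : ∃ φ : Fin m → ℝ, b ⬝ᵥ φ = -1 :=
    ⟨(-(b ⬝ᵥ b)⁻¹) • b, by rw [dotProduct_smul, smul_eq_mul, neg_mul, inv_mul_cancel₀ hbb]⟩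
  set w := B *ᵥ φ with hw
  have hclosed : ∀ v : Fin n → ℝ, A + Matrix.vecMulVec v a + (B + Matrix.vecMulVec v b) * K =
      A + B * K + Matrix.vecMulVec v c := by
    intro v
    rw [Matrix.add_mul, Matrix.vecMulVec_mul, hcdef, Matrix.vecMulVec_add]
    abel
  have hgain : ∀ (v : Fin n → ℝ) (τ : ℝ),
      A + Matrix.vecMulVec v a +
        (B + Matrix.vecMulVec v b) * (K + Matrix.vecMulVec (τ • φ) c) =
      A + B * K + Matrix.vecMulVec (τ • w + (1 - τ) • v) c := by
    intro v τ
    have h1 : (B + Matrix.vecMulVec v b) *ᵥ (τ • φ) = τ • w - τ • v := by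
      rw [Matrix.mulVec_smul, Matrix.add_mulVec, Matrix.vecMulVec_mulVec, hφ, hw]
      ext i
      simp
      ring
    rw [Matrix.mul_add, ← add_assoc, hclosed, Matrix.mul_vecMulVec, h1, add_assoc,
      ← Matrix.add_vecMulVec]
    congr 2
    rw [sub_smul, one_smul]
    abel
  by_cases hS : IsSchur (A + B * K + Matrix.vecMulVec w c)
  -- Taking `τ = 1` removes `v` from the closed loop, so `v` is free to destroy the Schur property
  -- under `K`.
  · obtain ⟨v, hv⟩ := exists_not_isSchur_add_vecMulVec (A + B * K) hc
    refine ⟨v, ⟨K + Matrix.vecMulVec ((1 : ℝ) • φ) c, ?_⟩, ?_⟩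
    · rw [hgain]
      simpa using hS
    · rwa [hclosed]
  · obtain ⟨s, hs1, hs⟩ := hK.exists_not_isSchur_add_smul_vecMulVec hS
    have hs0 : s - 1 ≠ 0 := by linarith
    -- This `τ` solves `τ + (1 - τ) s = 0`, which restores the closed loop `A + B * K`; it exists
    -- because `s ≠ 1`.
    refine ⟨s • w, ⟨K + Matrix.vecMulVec ((s / (s - 1)) • φ) c, ?_⟩, ?_⟩
    · have h0 : (s / (s - 1)) • w + (1 - s / (s - 1)) • s • w = 0 := by
        rw [smul_smul, ← add_smul]
        convert zero_smul ℝ w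
        field_simp
        ring
      rw [hgain, h0]
      simpa using hK
    · rwa [hclosed, Matrix.smul_vecMulVec]

/-- A matrix of full row rank has trivial left kernel. -/
theorem Matrix.eq_zero_of_vecMul_eq_zero_of_rank_eq {n T : ℕ} {X : Matrix (Fin n) (Fin T) ℝ}
    (hX : X.rank = n) {a : Fin n → ℝ} (ha : a ᵥ* X = 0) : a = 0 := by
  have hli : LinearIndependent ℝ X.row := by
    rw [linearIndependent_iff_card_eq_finrank_span, Fintype.card_fin, Set.finrank,
      ← Matrix.rank_eq_finrank_span_row, hX]
  exact Matrix.vecMul_injective_iff.2 hli (by simpa using ha)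

namespace InputStateData

variable {n m T : ℕ}

theorem CollectedFrom.mem_consistentSystems {D : InputStateData n m T} {S : LTISystem n m}
    (h : D.CollectedFrom S) : S ∈ D.consistentSystems := by
  ext i t
  exact congrFun (h t) i

/-- A gain that stabilizes all stabilizable consistent systems annihilates the left kernel of the
data matrix. -/
theorem add_vecMul_eq_zero_of_stabilizing {D : InputStateData n m T} {S : LTISystem n m}
    (hS : S ∈ D.consistentSystems) (hstab : S ∈ stabSystems n m) (hrank : D.Xminus.rank = n)
    {K : Matrix (Fin m) (Fin n) ℝ}
    (hK : ∀ S ∈ D.consistentSystems ∩ stabSystems n m, IsSchur (S.1 + S.2 * K))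
    {a : Fin n → ℝ} {b : Fin m → ℝ} (hab : a ᵥ* D.Xminus + b ᵥ* D.Uminus = 0) :
    a + b ᵥ* K = 0 := by
  by_contra hc
  have hb : b ≠ 0 := by
    rintro rfl
    have ha : a = 0 := Matrix.eq_zero_of_vecMul_eq_zero_of_rank_eq hrank (by simpa using hab)
    simp [ha] at hc
  obtain ⟨v, hv, hv'⟩ := exists_isStabilizable_not_isSchur (hK S ⟨hS, hstab⟩) hb hc
  refine hv' (hK (S.1 + Matrix.vecMulVec v a, S.2 + Matrix.vecMulVec v b) ⟨?_, hv⟩)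
  have hS' : D.Xplus = S.1 * D.Xminus + S.2 * D.Uminus := hS
  change D.Xplus = (S.1 + Matrix.vecMulVec v a) * D.Xminus +
    (S.2 + Matrix.vecMulVec v b) * D.Uminus
  rw [Matrix.add_mul, Matrix.add_mul, Matrix.vecMulVec_mul, Matrix.vecMulVec_mul,
    add_add_add_comm, ← Matrix.vecMulVec_add, hab, ← hS', left_eq_add]
  ext i j
  simp [Matrix.vecMulVec_apply]

/-- A gain that stabilizes all stabilizable consistent systems yields the same closed loop for all
consistent systems. -/
theorem closedLoop_eq_of_stabilizing {D : InputStateData n m T} {S S' : LTISystem n m}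
    (hS : S ∈ D.consistentSystems) (hstab : S ∈ stabSystems n m) (hrank : D.Xminus.rank = n)
    {K : Matrix (Fin m) (Fin n) ℝ}
    (hK : ∀ S ∈ D.consistentSystems ∩ stabSystems n m, IsSchur (S.1 + S.2 * K))
    (hS' : S' ∈ D.consistentSystems) : S'.1 + S'.2 * K = S.1 + S.2 * K := by
  have hdiff : (S'.1 - S.1) * D.Xminus + (S'.2 - S.2) * D.Uminus = 0 := by
    have h1 : D.Xplus = S'.1 * D.Xminus + S'.2 * D.Uminus := hS'
    have h2 : D.Xplus = S.1 * D.Xminus + S.2 * D.Uminus := hS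
    rw [Matrix.sub_mul, Matrix.sub_mul, sub_add_sub_comm, ← h1, ← h2, sub_self]
  have hzero : (S'.1 - S.1) + (S'.2 - S.2) * K = 0 := by
    ext i j
    -- Each row of the difference lies in the left kernel of the stacked data.
    have hrow : (S'.1 - S.1).row i ᵥ* D.Xminus + (S'.2 - S.2).row i ᵥ* D.Uminus = 0 := by
      ext t
      exact congrFun (congrFun hdiff i) t
    exact congrFun (add_vecMul_eq_zero_of_stabilizing hS hstab hrank hK hrow) j
  rw [← sub_eq_zero, ← hzero, Matrix.sub_mul]
  abel

end InputStateData

theorem theorem3 {n m T : ℕ} (D : InputStateData n m T)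
    (Atrue : Matrix (Fin n) (Fin n) ℝ) (Btrue : Matrix (Fin n) (Fin m) ℝ)
    (hdata : D.CollectedFrom (Atrue, Btrue))
    (hstab : (Atrue, Btrue) ∈ stabSystems n m)
    (hrank : D.Xminus.rank = n) :
    D.PriorInformativeForStabilization (stabSystems n m) ↔ D.InformativeForStabilization := by
  constructor
  swap
  · rintro ⟨K, hK⟩
    exact ⟨K, fun S hS => hK S hS.1⟩
  rintro ⟨K, hK⟩
  refine ⟨K, fun S hS => ?_⟩
  have htrue := hdata.mem_consistentSystems
  rw [InputStateData.closedLoop_eq_of_stabilizing htrue hstab hrank hK hS]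
  exact hK _ ⟨htrue, hstab⟩
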